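/- Let $F$ be a field of characteristic $2$. For a power series $f\in F[[x_1,\dots,x_s]]$ and $n\ge 0$ put $q=2^n$ and $$e_n(f)=\dim_F F[[x_1,\dots,x_s]]/(x_1^q,\dots,x_s^q,f);$$ for $s\ge 1$ and $f\neq 0$ without constant term, the Hilbert–Kunz multiplicity of $f$ is $\lim_{n\to\infty} e_n(f)/2^{n(s-1)}$. For a power series $g$ in $r$ variables over $F$, let $u,v$ be two further variables, view $uv+g$ as a power series in $r+2$ variables, and put $$\theta_g=(1-2^{r+1}w)\sum_{n\ge 0}e_n(uv+g)\,w^n\in\mathbb Z[[w]].$$ Let $(g_i)$ be a finite family of power series over $F$ without constant term, where $g_i$ is in $r_i$ variables and the variables of distinct $g_i$ are pairwise disjoint; view $uv+\sum_i g_i$ as a power series in $2+\sum_i r_i$ variables. Let $\sum_n c_n w^n$ be the Hadamard (coefficientwise) product of the $\theta_{g_i}$, so that $c_n$ is the product over $i$ of the coefficients of $w^n$ in the $\theta_{g_i}$. Then the Hilbert–Kunz multiplicity of $uv+\sum_i g_i$ exists, the series $\sum_n c_n\left(2^{-(1+\sum_i r_i)}\right)^n$ converges absolutely, and its sum is that multiplicity: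 $$\lim_{n\to\infty}\frac{e_n\bigl(uv+\sum_i g_i\bigr)}{2^{n(1+\sum_i r_i)}}=\sum_{n\ge 0}c_n\,2^{-n(1+\sum_i r_i)}.$$ -/

import Mathlib

open Filter Topology

noncomputable section

/-- The Hilbert-Kunz function `n ↦ eₙ(f)` of a power series `f` over a field `F` of characteristic
`2`: the dimension over `F` of `F[[x₁, …, xᵣ]] / (x₁ ^ q, …, xᵣ ^ q, f)`, where `q = 2 ^ n`. -/
def hkFunction {F : Type*} [Field F] {σ : Type*} (f : MvPowerSeries σ F) (n : ℕ) : ℕ :=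
  Module.finrank F
    (MvPowerSeries σ F ⧸
      Ideal.span (Set.range (fun j : σ ↦ (MvPowerSeries.X j : MvPowerSeries σ F) ^ 2 ^ n) ∪ {f}))

/-- The sequence `eₙ(f) / q ^ (s - 1)`, `q = 2 ^ n`, for a power series `f` in `s` variables; here
`s - 1` is the dimension of the hypersurface ring `F[[x₁, …, xₛ]] / (f)` (for `f` nonzero and
without constant term, hence `s ≥ 1`). -/
def hkRatio {F : Type*} [Field F] {σ : Type*} [Fintype σ] (f : MvPowerSeries σ F) (n : ℕ) : ℝ :=
  (hkFunction f n : ℝ) / ((2 : ℝ) ^ n) ^ (Fintype.card σ - 1)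

/-- The Hilbert-Kunz multiplicity of `f`: the limit of `eₙ(f) / q ^ (s - 1)`. -/
def hkMultiplicity {F : Type*} [Field F] {σ : Type*} [Fintype σ] (f : MvPowerSeries σ F) : ℝ :=
  limUnder atTop (hkRatio f)

/-- For `g` in the variables `σ`, the power series `uv + g` in the variables `σ` together with two
new variables `u`, `v`. -/
def uvAdd {F : Type*} [Field F] {σ : Type*} (g : MvPowerSeries σ F) :
    MvPowerSeries (σ ⊕ Fin 2) F :=
  MvPowerSeries.X (Sum.inr 0) * MvPowerSeries.X (Sum.inr 1) + MvPowerSeries.rename Function.Embedding.inl g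

/-- `θ_g = (1 - 2 ^ (r + 1) w) ∑ₙ eₙ(uv + g) wⁿ` in `ℤ[[w]]`, for `g` in `r` variables. -/
def theta {F : Type*} [Field F] {σ : Type*} [Fintype σ] (g : MvPowerSeries σ F) : PowerSeries ℤ :=
  (1 - PowerSeries.C ((2 : ℤ) ^ (Fintype.card σ + 1)) * PowerSeries.X) *
    PowerSeries.mk fun n ↦ (hkFunction (uvAdd g) n : ℤ)

/-- The Hadamard (coefficientwise) product of finitely many power series. -/
def hadamardProd {ι : Type*} [Fintype ι] (θ : ι → PowerSeries ℤ) : PowerSeries ℤ :=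
  PowerSeries.mk fun n ↦ ∏ i, PowerSeries.coeff n (θ i)

/-- The sum `∑ gᵢ` of power series in pairwise disjoint sets `σ i` of variables, as a power series
in all these variables. -/
def disjointSum {F : Type*} [Field F] {ι : Type*} [Fintype ι] {σ : ι → Type*}
    (g : ∀ i, MvPowerSeries (σ i) F) : MvPowerSeries (Σ i, σ i) F :=
  ∑ i, MvPowerSeries.rename (Function.Embedding.sigmaMk i) (g i)

end

/-! Let T be multiplication by g on A_q = F[[x]]/(x_j^q), q = 2^n, and let k_j be the dimension of
ker T^j. Multiplication by uv on F[[u,v]]/(u^q,v^q) is a diagonal shift of a q × q grid of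
monomials, and reading off the kernel of T ⊗ 1 + 1 ⊗ uv gives e_n(uv+g) = ∑_{j<q} (k_j + k_{j+1})
(`hkFunction_uvAdd`). Frobenius makes A_{2q} free over the squares, so k_{2j} for 2q is 2^r times
k_j for q (`kerDim_truncMul_two_mul`). Subtracting 2^(r+1) e_{n-1} from e_n therefore leaves an
alternating sum: the coefficient of w^n in θ_g is the number of odd Jordan blocks of T
(`coeff_theta`).

The heart is that in characteristic 2 this number is multiplicative under T ⊗ 1 + 1 ⊗ S when T^q =
S^q = 0 (`oddBlocks_tensorSum_and_nonneg`). With q = 2h, T^h is a differential. A block of size s ≤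
h survives in its homology, and one of size s > h becomes a block of size 2h - s, so parity is
preserved. Since (T ⊗ 1 + 1 ⊗ S)^h = T^h ⊗ 1 + 1 ⊗ S^h, Künneth lowers the exponent from q to h; at
q = 1 both maps are 0 and the count is the dimension.

Hence θ of the disjoint sum is the Hadamard product of the θ_{g_i}. The ratios e_n/2^{n(r+1)}
telescope to partial sums of its nonnegative terms and are bounded by 2, so both limits exist and
agree. -/

open TensorProduct

universe u v

noncomputable section

/-! ### Kernels of powers and odd Jordan blocks -/

section LinearAlgebra

variable {F : Type*} [Field F] {M N H K : Type*} [AddCommGroup M] [Module F M]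
  [AddCommGroup N] [Module F N] [AddCommGroup H] [Module F H] [AddCommGroup K] [Module F K]

/-- The dimension of the kernel of `T ^ j`. -/
def kerDim (T : Module.End F M) (j : ℕ) : ℕ := Module.finrank F (LinearMap.ker (T ^ j))

/-- For an endomorphism `T` with `T ^ q = 0`, the number of Jordan blocks of odd size. -/
def oddBlocks (T : Module.End F M) (q : ℕ) : ℤ :=
  ∑ j ∈ Finset.range q, (-1) ^ j * ((kerDim T (j + 1) : ℤ) - kerDim T j)

/-- The endomorphism `T ⊗ 1 + 1 ⊗ S` of `M ⊗ N`. -/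
def tensorSum (T : Module.End F M) (S : Module.End F N) : Module.End F (M ⊗[F] N) :=
  TensorProduct.map T LinearMap.id + TensorProduct.map LinearMap.id S

@[simp]
theorem tensorSum_tmul (T : Module.End F M) (S : Module.End F N) (x : M) (y : N) :
    tensorSum T S (x ⊗ₜ y) = T x ⊗ₜ y + x ⊗ₜ S y := by
  simp [tensorSum]

theorem kerDim_zero (T : Module.End F M) : kerDim T 0 = 0 := by
  have : LinearMap.ker (T ^ 0) = ⊥ := by
    rw [pow_zero]; exact LinearMap.ker_id
  rw [kerDim, this, finrank_bot]

theorem kerDim_of_pow_eq_zero {T : Module.End F M} {j : ℕ} (h : T ^ j = 0) :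
    kerDim T j = Module.finrank F M := by
  rw [kerDim, h, LinearMap.ker_zero, finrank_top]

theorem kerDim_le [FiniteDimensional F M] (T : Module.End F M) (j : ℕ) :
    kerDim T j ≤ Module.finrank F M :=
  Submodule.finrank_le _

theorem semiconj_pow_apply {T : Module.End F M} {S : Module.End F N} (e : M →ₗ[F] N)
    (h : ∀ x, e (T x) = S (e x)) (j : ℕ) (x : M) : e ((T ^ j) x) = (S ^ j) (e x) := by
  induction j generalizing x with
  | zero => simp
  | succ j ih => rw [pow_succ, pow_succ, Module.End.mul_apply, Module.End.mul_apply, ih, h]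

theorem kerDim_congr {T : Module.End F M} {S : Module.End F N} (e : M ≃ₗ[F] N)
    (h : ∀ x, e (T x) = S (e x)) (j : ℕ) : kerDim T j = kerDim S j := by
  have : (LinearMap.ker (T ^ j)).map e.toLinearMap = LinearMap.ker (S ^ j) := by
    ext y
    obtain ⟨x, rfl⟩ := e.surjective y
    have := semiconj_pow_apply e.toLinearMap h j x
    simp only [LinearEquiv.coe_coe] at this
    simp [← this]
  rw [kerDim, kerDim, ← this]
  exact (LinearEquiv.finrank_map_eq e _).symm

theorem oddBlocks_congr {T : Module.End F M} {S : Module.End F N} (e : M ≃ₗ[F] N)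
    (h : ∀ x, e (T x) = S (e x)) (q : ℕ) : oddBlocks T q = oddBlocks S q := by
  simp only [oddBlocks, kerDim_congr e h]

theorem finrank_map_add_finrank_inf_ker [FiniteDimensional F M] (f : M →ₗ[F] N)
    (W : Submodule F M) :
    Module.finrank F (W.map f) + Module.finrank F (W ⊓ LinearMap.ker f : Submodule F M) =
      Module.finrank F W := by
  have h := LinearMap.finrank_range_add_finrank_ker (f.domRestrict W)
  rw [LinearMap.range_domRestrict, LinearMap.ker_domRestrict] at h
  rw [← h]
  congr 1
  rw [← Submodule.map_comap_subtype, Submodule.finrank_map_subtype_eq]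

/-! ### Homology of a differential and Künneth in characteristic 2 -/

/-- `(H, T')` is the homology of `d`, with the endomorphism induced by `T`, where the projection
from the cycles is extended to a map `ρ` on the whole space that kills the boundaries. -/
structure IsHomology (d T : Module.End F M) (T' : Module.End F H) (ρ : M →ₗ[F] H) : Prop where
  map_boundary : ∀ x, ρ (d x) = 0
  exact : ∀ x, d x = 0 → ρ x = 0 → ∃ y, d y = x
  surj : ∀ y, ∃ x, d x = 0 ∧ ρ x = y
  comm : ∀ x, d x = 0 → ρ (T x) = T' (ρ x)

theorem exists_apply_apply_apply_eq (d : Module.End F M) :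
    ∃ k : Module.End F M, ∀ x, d (k (d x)) = d x := by
  obtain ⟨s, hs⟩ := d.rangeRestrict.exists_rightInverse_of_surjective d.range_rangeRestrict
  obtain ⟨k, hk⟩ := s.exists_extend
  refine ⟨k, fun x ↦ ?_⟩
  have h1 : k (d x) = s (d.rangeRestrict x) := by
    rw [← hk]; rfl
  have h2 := LinearMap.congr_fun hs (d.rangeRestrict x)
  rw [h1]
  exact congrArg Subtype.val h2

theorem exists_section {d : Module.End F M} {ρ : M →ₗ[F] H}
    (h : ∀ y, ∃ x, d x = 0 ∧ ρ x = y) :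
    ∃ s : H →ₗ[F] M, (∀ y, d (s y) = 0) ∧ ∀ y, ρ (s y) = y := by
  have hsurj : LinearMap.range (ρ.domRestrict (LinearMap.ker d)) = ⊤ := by
    rw [LinearMap.range_eq_top]
    intro y
    obtain ⟨x, hx, hy⟩ := h y
    exact ⟨⟨x, hx⟩, hy⟩
  obtain ⟨s, hs⟩ := (ρ.domRestrict (LinearMap.ker d)).exists_rightInverse_of_surjective hsurj
  exact ⟨(LinearMap.ker d).subtype ∘ₗ s, fun y ↦ (s y).2, fun y ↦ LinearMap.congr_fun hs y⟩

/-- The homology lives in the universe of `M`, so the later induction on the exponent can be applied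
to it. -/
theorem exists_isHomology {M : Type u} [AddCommGroup M] [Module F M] {d T : Module.End F M}
    (hd : ∀ x, d (d x) = 0) (hT : Commute T d) :
    ∃ (H : Type u) (_ : AddCommGroup H) (_ : Module F H) (T' : Module.End F H) (ρ : M →ₗ[F] H),
      IsHomology d T T' ρ := by
  obtain ⟨k, hk⟩ := exists_apply_apply_apply_eq d
  have hTd : ∀ x, T (d x) = d (T x) := fun x ↦ LinearMap.congr_fun hT.eq x
  let e : M →ₗ[F] LinearMap.ker d :=
    LinearMap.codRestrict _ (LinearMap.id - d ∘ₗ k - k ∘ₗ d) fun x ↦ by simp [hd, hk]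
  have he : ∀ x, (e x : M) = x - d (k x) - k (d x) := fun x ↦ rfl
  let B := (LinearMap.range d).comap (LinearMap.ker d).subtype
  let ρ := B.mkQ ∘ₗ e
  have h1 : ∀ x, ρ (d x) = 0 := fun x ↦ by
    have : e (d x) = 0 := Subtype.ext (by simp [he, hd, hk])
    simp [ρ, this]
  have h2 : ∀ x, d x = 0 → ρ x = 0 → ∃ y, d y = x := fun x hx hρ ↦ by
    have : e x ∈ B := by simpa [ρ] using hρ
    obtain ⟨y, hy⟩ := this
    refine ⟨y + k x, ?_⟩
    rw [map_add, hy]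
    simp [he, hx]
  have h3 : ∀ y, ∃ x, d x = 0 ∧ ρ x = y := fun y ↦ by
    obtain ⟨z, rfl⟩ := B.mkQ_surjective y
    refine ⟨z, z.2, ?_⟩
    have : d z = 0 := z.2
    change B.mkQ (e z) = B.mkQ z
    rw [← sub_eq_zero, ← map_sub, Submodule.mkQ_apply, Submodule.Quotient.mk_eq_zero]
    exact ⟨-k z, by simp [he, this]⟩
  obtain ⟨s, hs, hs'⟩ := exists_section h3
  refine ⟨_, inferInstance, inferInstance, ρ ∘ₗ T ∘ₗ s, ρ, h1, h2, h3, fun x hx ↦ ?_⟩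
  obtain ⟨y, hy⟩ := h2 (x - s (ρ x)) (by simp [hx, hs]) (by simp [hs'])
  have : ρ (T (x - s (ρ x))) = 0 := by rw [← hy, hTd, h1]
  simpa [sub_eq_zero] using this

/-- Over a field a complex retracts onto its homology; this homotopy is the input to Künneth. -/
theorem IsHomology.exists_homotopy {d T : Module.End F M} {T' : Module.End F H} {ρ : M →ₗ[F] H}
    (h : IsHomology d T T' ρ) (hd : ∀ x, d (d x) = 0) :
    ∃ (s : H →ₗ[F] M) (k : Module.End F M), (∀ y, d (s y) = 0) ∧ (∀ y, ρ (s y) = y) ∧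
      ∀ x, x = s (ρ x) + d (k x) + k (d x) := by
  obtain ⟨k, hk⟩ := exists_apply_apply_apply_eq d
  obtain ⟨s, hs, hs'⟩ := exists_section h.surj
  let e : Module.End F M := LinearMap.id - d ∘ₗ k - k ∘ₗ d
  have he : ∀ x, e x = x - d (k x) - k (d x) := fun x ↦ rfl
  have hed : ∀ x, d (e x) = 0 := fun x ↦ by simp [he, hd, hk]
  have hde : ∀ x, e (d x) = 0 := fun x ↦ by simp [he, hd, hk]
  -- The middle term contracts the boundary e x - s (ρ (e x)); the last one compensates for ρ (e x)
  -- differing from ρ x by ρ (k (d x)).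
  refine ⟨s, k + k ∘ₗ (LinearMap.id - s ∘ₗ ρ) ∘ₗ e - s ∘ₗ ρ ∘ₗ k, hs, hs', fun x ↦ ?_⟩
  obtain ⟨y, hy⟩ := h.exact (e x - s (ρ (e x))) (by simp [hed, hs]) (by simp [hs'])
  have h1 : d (k (e x - s (ρ (e x)))) = e x - s (ρ (e x)) := by rw [← hy, hk]
  have h2 : ρ (e x) = ρ x - ρ (k (d x)) := by simp [he, h.map_boundary]
  simp only [LinearMap.add_apply, LinearMap.sub_apply, LinearMap.comp_apply, LinearMap.id_apply,
    hde, map_add, map_sub d _ (s _), hs, map_zero, h1, sub_zero, add_zero]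
  rw [h2, he]
  simp only [map_sub]
  abel

/-- Künneth: homotopies onto the two homologies combine into one for the tensor product.
Characteristic 2 removes the usual signs. -/
theorem IsHomology.tensor [CharP F 2] {d T : Module.End F M} {T' : Module.End F H}
    {ρ : M →ₗ[F] H} {d' S : Module.End F N} {S' : Module.End F K} {ρ' : N →ₗ[F] K}
    (h : IsHomology d T T' ρ) (h' : IsHomology d' S S' ρ') (hd : ∀ x, d (d x) = 0)
    (hd' : ∀ x, d' (d' x) = 0) (hT : Commute T d) (hS : Commute S d') :
    IsHomology (tensorSum d d') (tensorSum T S) (tensorSum T' S') (TensorProduct.map ρ ρ') := by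
  have two (x : M ⊗[F] N) : x + x = 0 := by
    rw [← two_smul F, CharTwo.two_eq_zero, zero_smul]
  obtain ⟨s, k, hs, hs', hk⟩ := h.exists_homotopy hd
  obtain ⟨t, l, ht, ht', hl⟩ := h'.exists_homotopy hd'
  have hTd : ∀ x, T (d x) = d (T x) := fun x ↦ LinearMap.congr_fun hT.eq x
  have hSd : ∀ x, S (d' x) = d' (S x) := fun x ↦ LinearMap.congr_fun hS.eq x
  let L : Module.End F (M ⊗[F] N) :=
    TensorProduct.map k LinearMap.id + TensorProduct.map (s ∘ₗ ρ) l
  have hL (z : M ⊗[F] N) : z = TensorProduct.map s t (TensorProduct.map ρ ρ' z) +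
      tensorSum d d' (L z) + L (tensorSum d d' z) := by
    induction z with
    | zero => simp
    | add x y hx hy =>
      nth_rewrite 1 [hx, hy]
      simp only [map_add]
      abel
    | tmul x y =>
      have e1 : d (k x) ⊗ₜ[F] y + k (d x) ⊗ₜ[F] y = (x - s (ρ x)) ⊗ₜ[F] y := by
        rw [← TensorProduct.add_tmul]
        congr 1
        nth_rewrite 3 [hk x]
        abel
      have e2 : s (ρ x) ⊗ₜ[F] d' (l y) + s (ρ x) ⊗ₜ[F] l (d' y) =
          s (ρ x) ⊗ₜ[F] (y - t (ρ' y)) := by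
        rw [← TensorProduct.tmul_add]
        congr 1
        nth_rewrite 3 [hl y]
        abel
      simp only [L, TensorProduct.map_tmul, LinearMap.add_apply, LinearMap.comp_apply,
        LinearMap.id_apply, map_add, tensorSum_tmul, hs, h.map_boundary, map_zero,
        TensorProduct.zero_tmul, zero_add]
      rw [TensorProduct.sub_tmul] at e1
      rw [TensorProduct.tmul_sub] at e2
      -- The cross term k x ⊗ d' y occurs twice, once from each side of the homotopy.
      have e3 := two (k x ⊗ₜ[F] d' y)
      linear_combination (norm := module) (-1 : F) • e1 - (1 : F) • e2 - (1 : F) • e3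
  have hmb (z : M ⊗[F] N) : TensorProduct.map ρ ρ' (tensorSum d d' z) = 0 := by
    induction z with
    | zero => simp
    | add x y hx hy => simp [hx, hy]
    | tmul x y => simp [h.map_boundary, h'.map_boundary]
  have hcomm (z : M ⊗[F] N) :
      tensorSum T S (tensorSum d d' z) = tensorSum d d' (tensorSum T S z) := by
    induction z with
    | zero => simp
    | add x y hx hy => simp [hx, hy]
    | tmul x y =>
      simp only [tensorSum_tmul, map_add, hTd, hSd]
      abel
  refine ⟨hmb, fun z hz hρ ↦ ⟨L z, ?_⟩, fun y ↦ ⟨TensorProduct.map s t y, ?_, ?_⟩, fun z hz ↦ ?_⟩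
  · conv_rhs => rw [hL z, hz, hρ]
    simp
  · induction y with
    | zero => simp
    | add x y hx hy => simp [hx, hy]
    | tmul x y => simp [hs, ht]
  · induction y with
    | zero => simp
    | add x y hx hy => simp [hx, hy]
    | tmul x y => simp [hs', ht']
  · have key (y : H ⊗[F] K) : TensorProduct.map ρ ρ' (tensorSum T S (TensorProduct.map s t y)) =
        tensorSum T' S' y := by
      induction y with
      | zero => simp
      | add x y hx hy => simp [hx, hy]
      | tmul x y => simp [hs', ht', h.comm _ (hs _), h'.comm _ (ht _)]
    conv_lhs => rw [hL z, hz]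
    rw [map_zero, add_zero, map_add, map_add, key, hcomm, hmb, add_zero]

/-! ### Odd Jordan blocks are preserved by passing to homology -/

theorem IsHomology.kerDim_add [FiniteDimensional F M] {T : Module.End F M} {h : ℕ}
    {T' : Module.End F H} {ρ : M →ₗ[F] H} (hH : IsHomology (T ^ h) T T' ρ) (hT : T ^ (2 * h) = 0)
    {j : ℕ} (hj : j ≤ h) :
    kerDim T' j + Module.finrank F M = kerDim T j + kerDim T (2 * h - j) := by
  have hpow (a b : ℕ) (x : M) : (T ^ a) ((T ^ b) x) = (T ^ (a + b)) x := by
    rw [pow_add, Module.End.mul_apply]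
  have hz (a : ℕ) (x : M) (ha : 2 * h ≤ a) : (T ^ a) x = 0 := by
    rw [pow_eq_zero_of_le ha hT, LinearMap.zero_apply]
  have hρ (i : ℕ) (x : M) (hx : (T ^ h) x = 0) : ρ ((T ^ i) x) = (T' ^ i) (ρ x) := by
    induction i with
    | zero => simp
    | succ i ih =>
      rw [pow_succ', Module.End.mul_apply, hH.comm, ih, pow_succ', Module.End.mul_apply]
      rw [hpow, add_comm, ← hpow, hx, map_zero]
  -- `W` consists of the cycles whose class is killed by T'^j. Its dimension is computed twice,
  -- through ρ and through T^j.
  let W := LinearMap.ker (T ^ h) ⊓ (LinearMap.range (T ^ h)).comap (T ^ j)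
  have e1 : W.map ρ = LinearMap.ker (T' ^ j) := by
    ext y
    constructor
    · rintro ⟨x, ⟨hx, ⟨z, hz⟩⟩, rfl⟩
      rw [LinearMap.mem_ker, ← hρ j x hx, ← hz, hH.map_boundary]
    · intro hy
      obtain ⟨x, hx, rfl⟩ := hH.surj y
      refine ⟨x, ⟨hx, ?_⟩, rfl⟩
      refine hH.exact _ ?_ ?_
      · rw [hpow, add_comm, ← hpow, hx, map_zero]
      · rw [hρ j x hx]; exact hy
  have e2 : W ⊓ LinearMap.ker ρ = LinearMap.range (T ^ h) := by
    ext x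
    constructor
    · rintro ⟨⟨hx, _⟩, hx'⟩
      exact hH.exact x hx hx'
    · rintro ⟨y, rfl⟩
      refine ⟨⟨?_, ⟨(T ^ j) y, ?_⟩⟩, hH.map_boundary y⟩
      · change (T ^ h) _ = 0
        rw [hpow]; exact hz _ _ (by omega)
      · rw [hpow, hpow, add_comm]
  have e3 : W.map (T ^ j) = (LinearMap.ker (T ^ (2 * h - j))).map (T ^ h) := by
    ext y
    constructor
    · rintro ⟨x, ⟨hx, ⟨z, hz'⟩⟩, rfl⟩
      refine ⟨z, ?_, hz'⟩
      change (T ^ (2 * h - j)) z = 0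
      rw [show 2 * h - j = (h - j) + h by omega, ← hpow, hz', hpow, Nat.sub_add_cancel hj]
      exact hx
    · rintro ⟨z, hz', rfl⟩
      refine ⟨(T ^ (h - j)) z, ⟨?_, ⟨z, ?_⟩⟩, ?_⟩
      · change (T ^ h) _ = 0
        rw [hpow, show h + (h - j) = 2 * h - j by omega]; exact hz'
      · rw [hpow, Nat.add_sub_cancel' hj]
      · rw [hpow, Nat.add_sub_cancel' hj]
  have e4 : W ⊓ LinearMap.ker (T ^ j) = LinearMap.ker (T ^ j) := by
    rw [inf_eq_right]
    intro x (hx : (T ^ j) x = 0)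
    refine ⟨?_, ⟨0, ?_⟩⟩
    · change (T ^ h) x = 0
      rw [show h = (h - j) + j by omega, ← hpow, hx, map_zero]
    · rw [map_zero, hx]
  have e5 : LinearMap.ker (T ^ (2 * h - j)) ⊓ LinearMap.ker (T ^ h) = LinearMap.ker (T ^ h) := by
    rw [inf_eq_right]
    intro x (hx : (T ^ h) x = 0)
    change (T ^ (2 * h - j)) x = 0
    rw [show 2 * h - j = (h - j) + h by omega, ← hpow, hx, map_zero]
  have f1 := finrank_map_add_finrank_inf_ker ρ W
  have f2 := finrank_map_add_finrank_inf_ker (T ^ j) W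
  have f3 := finrank_map_add_finrank_inf_ker (T ^ h) (LinearMap.ker (T ^ (2 * h - j)))
  have f4 := LinearMap.finrank_range_add_finrank_ker (T ^ h)
  rw [e1, e2] at f1
  rw [e3, e4] at f2
  rw [e5] at f3
  unfold kerDim
  omega

/-- By `kerDim_add` the increments of `kerDim T'` are those of `kerDim T` at j minus those at 2h - 1
- j. These indices have opposite parity, so folding the alternating sum at h adds up correctly. -/
theorem IsHomology.oddBlocks_eq [FiniteDimensional F M] {T : Module.End F M} {h : ℕ}
    {T' : Module.End F H} {ρ : M →ₗ[F] H} (hH : IsHomology (T ^ h) T T' ρ)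
    (hT : T ^ (2 * h) = 0) : oddBlocks T' h = oddBlocks T (2 * h) := by
  have key (j : ℕ) (hj : j ≤ h) : (kerDim T' j : ℤ) =
      kerDim T j + kerDim T (2 * h - j) - Module.finrank F M := by
    have := hH.kerDim_add hT hj
    omega
  have e : ∑ j ∈ Finset.range h, (-1 : ℤ) ^ (h + j) *
      ((kerDim T (h + j + 1) : ℤ) - kerDim T (h + j)) = ∑ j ∈ Finset.range h,
      (-1 : ℤ) ^ j * ((kerDim T (2 * h - (j + 1)) : ℤ) - kerDim T (2 * h - j)) := by
    rw [← Finset.sum_range_reflect]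
    refine Finset.sum_congr rfl fun j hj ↦ ?_
    have hj := Finset.mem_range.1 hj
    rw [show h + (h - 1 - j) + 1 = 2 * h - j by omega,
      show h + (h - 1 - j) = 2 * h - (j + 1) by omega]
    have : (-1 : ℤ) ^ (2 * h - (j + 1)) = -(-1) ^ j := by
      rcases Nat.even_or_odd j with hp | hp
      · rw [hp.neg_one_pow, Odd.neg_one_pow]
        rw [Nat.even_iff] at hp
        rw [Nat.odd_iff]
        omega
      · rw [hp.neg_one_pow, neg_neg, Even.neg_one_pow]
        rw [Nat.odd_iff] at hp
        rw [Nat.even_iff]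
        omega
    rw [this]
    ring
  unfold oddBlocks
  rw [two_mul h, Finset.sum_range_add, e, ← Finset.sum_add_distrib]
  refine Finset.sum_congr rfl fun j hj ↦ ?_
  have hj := Finset.mem_range.1 hj
  rw [key j hj.le, key (j + 1) hj]
  ring

theorem IsHomology.pow_eq_zero {T : Module.End F M} {h : ℕ} {T' : Module.End F H} {ρ : M →ₗ[F] H}
    (hH : IsHomology (T ^ h) T T' ρ) : T' ^ h = 0 := by
  have hρ (i : ℕ) (x : M) (hx : (T ^ h) x = 0) : ρ ((T ^ i) x) = (T' ^ i) (ρ x) := by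
    induction i with
    | zero => simp
    | succ i ih =>
      rw [pow_succ', Module.End.mul_apply, hH.comm, ih, pow_succ', Module.End.mul_apply]
      rw [← Module.End.mul_apply, ← pow_add, add_comm, pow_add, Module.End.mul_apply, hx, map_zero]
  ext y
  obtain ⟨x, hx, rfl⟩ := hH.surj y
  rw [← hρ h x hx, hx, map_zero, LinearMap.zero_apply]

theorem tensorSum_pow_two_pow [CharP F 2] (T : Module.End F M) (S : Module.End F N) (n : ℕ) :
    tensorSum T S ^ 2 ^ n = tensorSum (T ^ 2 ^ n) (S ^ 2 ^ n) := by
  induction n with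
  | zero => simp
  | succ n ih =>
    rw [pow_succ, pow_mul, pow_mul, pow_mul, ih]
    refine TensorProduct.ext' fun x y ↦ ?_
    have (z : M ⊗[F] N) : z + z = 0 := by
      rw [← two_smul F, CharTwo.two_eq_zero, zero_smul]
    simp only [pow_two, Module.End.mul_apply, tensorSum_tmul, map_add]
    rw [add_add_add_comm, ← add_assoc, add_right_comm, add_assoc _ (_ ⊗ₜ[F] _) (_ ⊗ₜ[F] _)]
    have := this ((T ^ 2 ^ n) x ⊗ₜ[F] (S ^ 2 ^ n) y)
    linear_combination (norm := module) (1 : F) • this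

end LinearAlgebra

/-- Passing to homology of the 2^n-th powers halves the exponent 2^(n+1) and changes none of the
three counts. Nonnegativity comes from the same descent, ending at a dimension. -/
theorem oddBlocks_tensorSum_and_nonneg {F : Type*} [Field F] [CharP F 2] (n : ℕ) :
    ∀ {M : Type u} {N : Type v} [AddCommGroup M] [Module F M] [AddCommGroup N] [Module F N]
      [FiniteDimensional F M] [FiniteDimensional F N] {T : Module.End F M} {S : Module.End F N},
      T ^ 2 ^ n = 0 → S ^ 2 ^ n = 0 →
      oddBlocks (tensorSum T S) (2 ^ n) = oddBlocks T (2 ^ n) * oddBlocks S (2 ^ n) ∧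
        0 ≤ oddBlocks T (2 ^ n) := by
  induction n with
  | zero =>
    intro M N _ _ _ _ _ _ T S hT hS
    have hTS : tensorSum T S ^ 2 ^ 0 = 0 := by
      rw [tensorSum_pow_two_pow, hT, hS]
      simp [tensorSum]
    simp only [pow_zero] at hT hS hTS
    simp [oddBlocks, kerDim_zero, kerDim_of_pow_eq_zero hT, kerDim_of_pow_eq_zero hS,
      kerDim_of_pow_eq_zero hTS]
  | succ n ih =>
    intro M N _ _ _ _ _ _ T S hT hS
    have hTS : tensorSum T S ^ 2 ^ (n + 1) = 0 := by
      rw [tensorSum_pow_two_pow, hT, hS]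
      simp [tensorSum]
    rw [pow_succ, mul_comm] at hT hS hTS ⊢
    have hT' (x : M) : (T ^ 2 ^ n) ((T ^ 2 ^ n) x) = 0 := by
      rw [← Module.End.mul_apply, ← pow_add, ← two_mul, hT, LinearMap.zero_apply]
    have hS' (x : N) : (S ^ 2 ^ n) ((S ^ 2 ^ n) x) = 0 := by
      rw [← Module.End.mul_apply, ← pow_add, ← two_mul, hS, LinearMap.zero_apply]
    obtain ⟨H, _, _, T', ρ, h⟩ := exists_isHomology hT' (Commute.self_pow T _)
    obtain ⟨K, _, _, S', ρ', h'⟩ := exists_isHomology hS' (Commute.self_pow S _)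
    have : FiniteDimensional F H := Module.Finite.of_surjective ρ fun y ↦
      let ⟨x, _, hx⟩ := h.surj y; ⟨x, hx⟩
    have : FiniteDimensional F K := Module.Finite.of_surjective ρ' fun y ↦
      let ⟨x, _, hx⟩ := h'.surj y; ⟨x, hx⟩
    have ht := h.tensor h' hT' hS' (Commute.self_pow T _) (Commute.self_pow S _)
    rw [← tensorSum_pow_two_pow] at ht
    rw [← h.oddBlocks_eq hT, ← h'.oddBlocks_eq hS, ← ht.oddBlocks_eq hTS]
    exact ih h.pow_eq_zero h'.pow_eq_zero

/-! ### The truncated algebras F[[x]]/(x_j^q) -/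

namespace MvPowerSeries

variable {F : Type*} [Field F] {σ τ : Type*}

variable (F σ) in
/-- The ideal generated by the `q`-th powers of the variables. -/
abbrev truncIdeal (q : ℕ) : Ideal (MvPowerSeries σ F) :=
  Ideal.span (Set.range fun j : σ ↦ (X j : MvPowerSeries σ F) ^ q)

variable (F σ) in
/-- The algebra `F[[σ]] / (xⱼ ^ q)`. -/
def TruncAlg (q : ℕ) : Type _ := MvPowerSeries σ F ⧸ truncIdeal F σ q

instance (q : ℕ) : CommRing (TruncAlg F σ q) :=
  inferInstanceAs (CommRing (MvPowerSeries σ F ⧸ truncIdeal F σ q))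

instance (q : ℕ) : Algebra F (TruncAlg F σ q) :=
  inferInstanceAs (Algebra F (MvPowerSeries σ F ⧸ truncIdeal F σ q))

/-- The projection `F[[σ]] → F[[σ]] / (xⱼ ^ q)`. -/
def truncMk (q : ℕ) : MvPowerSeries σ F →ₐ[F] TruncAlg F σ q :=
  Ideal.Quotient.mkₐ F (truncIdeal F σ q)

theorem truncMk_surjective (q : ℕ) : Function.Surjective (truncMk (F := F) (σ := σ) q) :=
  Ideal.Quotient.mk_surjective

theorem truncMk_eq_zero_iff {q : ℕ} {f : MvPowerSeries σ F} :
    truncMk q f = 0 ↔ f ∈ truncIdeal F σ q :=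
  Ideal.Quotient.eq_zero_iff_mem

theorem truncMk_X_pow (q : ℕ) (j : σ) : truncMk (F := F) q (X j) ^ q = 0 := by
  rw [← map_pow, truncMk_eq_zero_iff]
  exact Ideal.subset_span ⟨j, rfl⟩

/-- Variables are peeled off one at a time: the terms of exponent at least q in x_i form a multiple
of x_i^q. -/
theorem mem_span_X_pow_of_coeff_eq_zero (q : ℕ) (s : Finset σ) (f : MvPowerSeries σ F)
    (hf : ∀ m : σ →₀ ℕ, (∀ j ∈ s, m j < q) → coeff m f = 0) : f ∈ truncIdeal F σ q := by
  classical
  induction s using Finset.induction_on generalizing f with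
  | empty =>
    have : f = 0 := by
      ext m
      exact hf m (by simp)
    rw [this]
    exact zero_mem _
  | insert i s hi ih =>
    let f₁ : MvPowerSeries σ F := fun m ↦ if m i < q then coeff m f else 0
    have h₁ (m : σ →₀ ℕ) : coeff m f₁ = if m i < q then coeff m f else 0 := rfl
    have h₂ : X i ^ q ∣ f - f₁ := by
      rw [X_pow_dvd_iff]
      intro m hm
      rw [map_sub, h₁, if_pos hm, sub_self]
    rw [← sub_add_cancel f f₁]
    refine add_mem (Ideal.mem_of_dvd _ h₂ (Ideal.subset_span ⟨i, rfl⟩)) (ih f₁ fun m hm ↦ ?_)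
    rw [h₁]
    split_ifs with h
    · refine hf m fun j hj ↦ ?_
      rcases Finset.mem_insert.1 hj with rfl | hj
      exacts [h, hm j hj]
    · rfl

theorem mem_truncIdeal_iff [Fintype σ] {q : ℕ} {f : MvPowerSeries σ F} :
    f ∈ truncIdeal F σ q ↔ ∀ m : σ →₀ ℕ, (∀ j, m j < q) → coeff m f = 0 := by
  refine ⟨fun hf m hm ↦ ?_, fun hf ↦
    mem_span_X_pow_of_coeff_eq_zero q Finset.univ f fun m hm ↦ hf m fun j ↦ hm j (by simp)⟩
  obtain ⟨c, rfl⟩ := (Ideal.mem_span_range_iff_exists_fun).1 hf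
  rw [map_sum]
  exact Finset.sum_eq_zero fun j _ ↦ X_pow_dvd_iff.1 (dvd_mul_left _ _) m (hm j)

/-- Multiplication by a power series on `F[[σ]] / (xⱼ ^ q)`. -/
def truncMul (q : ℕ) (f : MvPowerSeries σ F) : Module.End F (TruncAlg F σ q) :=
  LinearMap.mulLeft F (truncMk q f)

theorem truncMul_apply (q : ℕ) (f : MvPowerSeries σ F) (x : TruncAlg F σ q) :
    truncMul q f x = truncMk q f * x := rfl

theorem truncMul_pow_apply (q : ℕ) (f : MvPowerSeries σ F) (j : ℕ) (x : TruncAlg F σ q) :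
    (truncMul q f ^ j) x = truncMk q f ^ j * x := by
  rw [truncMul, LinearMap.pow_mulLeft, LinearMap.mulLeft_apply]

/-- The algebra map induced by an injection of the sets of variables. -/
def truncMap [Finite σ] (q : ℕ) (e : σ ↪ τ) : TruncAlg F σ q →ₐ[F] TruncAlg F τ q :=
  Ideal.Quotient.liftₐ _ ((truncMk q).comp (rename e)) fun f hf ↦ by
    have := Fintype.ofFinite σ
    obtain ⟨c, rfl⟩ := (Ideal.mem_span_range_iff_exists_fun).1 hf
    rw [map_sum]
    refine Finset.sum_eq_zero fun j _ ↦ ?_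
    rw [AlgHom.comp_apply, map_mul, map_mul, map_pow, map_pow, rename_X, truncMk_X_pow, mul_zero]

theorem truncMap_truncMk [Finite σ] (q : ℕ) (e : σ ↪ τ) (f : MvPowerSeries σ F) :
    truncMap q e (truncMk q f) = truncMk q (rename e f) := rfl

variable [Fintype σ] [Fintype τ]

theorem coeff_prod_X_pow [DecidableEq σ] (a : σ → ℕ) (m : σ →₀ ℕ) :
    coeff m (∏ j, (X j : MvPowerSeries σ F) ^ a j) = if ⇑m = a then 1 else 0 := by
  have : ∏ j, (X j : MvPowerSeries σ F) ^ a j = monomial (Finsupp.equivFunOnFinite.symm a) 1 := by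
    have (s : Finset σ) : ∏ j ∈ s, (X j : MvPowerSeries σ F) ^ a j =
        monomial (∑ j ∈ s, Finsupp.single j (a j)) 1 := by
      induction s using Finset.induction_on with
      | empty => simp
      | insert i s hi ih =>
        rw [Finset.prod_insert hi, Finset.sum_insert hi, ih, X_pow_eq, monomial_mul_monomial,
          mul_one]
    rw [this]
    congr 2
    ext j
    simp [Finsupp.finsetSum_apply, Finsupp.single_apply]
  rw [this, coeff_monomial]
  congr 1
  rw [eq_iff_iff]
  constructor
  · rintro rfl; rfl
  · rintro rfl; exact (Finsupp.equivFunOnFinite_symm_coe m).symm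

/-- The class of the monomial with exponent vector `a`. -/
def truncMonomial (q : ℕ) (a : σ → ℕ) : TruncAlg F σ q :=
  truncMk q (∏ j, X j ^ a j)

theorem truncMonomial_add (q : ℕ) (a b : σ → ℕ) :
    truncMonomial (F := F) q (a + b) = truncMonomial q a * truncMonomial q b := by
  simp only [truncMonomial, ← map_mul, ← Finset.prod_mul_distrib, Pi.add_apply, pow_add]

theorem truncMonomial_pow (q k : ℕ) (a : σ → ℕ) :
    truncMonomial (F := F) q a ^ k = truncMonomial q (k • a) := by
  simp only [truncMonomial, ← map_pow, ← Finset.prod_pow, Pi.smul_apply, smul_eq_mul, ← pow_mul,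
    mul_comm]

theorem truncMonomial_eq_zero {q : ℕ} {a : σ → ℕ} {j : σ} (h : q ≤ a j) :
    truncMonomial (F := F) q a = 0 := by
  exact truncMk_eq_zero_iff.2 (Ideal.mem_of_dvd _
    ((pow_dvd_pow _ h).trans (Finset.dvd_prod_of_mem _ (Finset.mem_univ j)))
    (Ideal.subset_span ⟨j, rfl⟩))

variable (F σ) in
/-- The monomial basis of `F[[σ]] / (xⱼ ^ q)`. -/
def truncBasis (q : ℕ) : Module.Basis (σ → Fin q) F (TruncAlg F σ q) := by
  classical
  have hcoeff (c : (σ → Fin q) → F) (m : σ →₀ ℕ) (a : σ → Fin q) (h : ∀ j, m j = a j) :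
      coeff m (∑ b, c b • ∏ j, (X j : MvPowerSeries σ F) ^ (b j : ℕ)) = c a := by
    rw [map_sum, Finset.sum_eq_single a]
    · rw [coeff_smul, coeff_prod_X_pow, if_pos (funext h), mul_one]
    · intro b _ hb
      rw [coeff_smul, coeff_prod_X_pow, if_neg, mul_zero]
      intro h'
      exact hb (funext fun j ↦ Fin.ext (by rw [← h j, h']))
    · simp
  have hsum (c : (σ → Fin q) → F) : ∑ b, c b • truncMonomial q (fun j ↦ (b j : ℕ)) =
      truncMk q
        (∑ b, c b • ∏ j, (X j : MvPowerSeries σ F) ^ (b j : ℕ)) := by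
    simp only [map_sum, map_smul, truncMonomial]
  refine Module.Basis.mk (v := fun a ↦ truncMonomial q fun j ↦ (a j : ℕ)) ?_ ?_
  · rw [Fintype.linearIndependent_iff]
    intro c hc a
    rw [hsum] at hc
    have := mem_truncIdeal_iff.1 (truncMk_eq_zero_iff.1 hc)
      (Finsupp.equivFunOnFinite.symm fun j ↦ (a j : ℕ)) fun j ↦ (a j).2
    rwa [hcoeff c _ a fun j ↦ rfl] at this
  · rintro x -
    obtain ⟨f, rfl⟩ := truncMk_surjective q x
    let c (a : σ → Fin q) : F := coeff (Finsupp.equivFunOnFinite.symm fun j ↦ (a j : ℕ)) f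
    have : truncMk q f = ∑ b, c b • truncMonomial q (fun j ↦ (b j : ℕ)) := by
      rw [hsum]
      rw [← sub_eq_zero, ← map_sub, truncMk_eq_zero_iff, mem_truncIdeal_iff]
      intro m hm
      rw [map_sub, hcoeff c m (fun j ↦ ⟨m j, hm j⟩) fun j ↦ rfl, sub_eq_zero]
      congr 2
      ext j
      rfl
    rw [this]
    exact sum_mem fun b _ ↦ Submodule.smul_mem _ _ (Submodule.subset_span ⟨b, rfl⟩)

theorem truncBasis_apply (q : ℕ) (a : σ → Fin q) :
    truncBasis F σ q a = truncMonomial q fun j ↦ (a j : ℕ) := by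
  simp [truncBasis]

instance (q : ℕ) : FiniteDimensional F (TruncAlg F σ q) :=
  have := Classical.decEq σ
  Module.Finite.of_basis (truncBasis F σ q)

variable (F σ) in
theorem finrank_truncAlg (q : ℕ) : Module.finrank F (TruncAlg F σ q) = q ^ Fintype.card σ := by
  classical
  rw [Module.finrank_eq_card_basis (truncBasis F σ q), Fintype.card_fun, Fintype.card_fin]

/-- Writing f = ∑ c_j x_j, Frobenius gives f^q = ∑ c_j^q x_j^q. -/
theorem truncMul_pow_two_pow [CharP F 2] (n : ℕ) {f : MvPowerSeries σ F}
    (hf : constantCoeff f = 0) : truncMul (2 ^ n) f ^ 2 ^ n = 0 := by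
  have : CharP (MvPowerSeries σ F) 2 := charP_of_injective_algebraMap (algebraMap F _).injective 2
  have hf' : f ∈ truncIdeal F σ 1 := by
    rw [mem_truncIdeal_iff]
    intro m hm
    have : m = 0 := by
      ext j
      simpa using hm j
    rw [this, coeff_zero_eq_constantCoeff_apply, hf]
  obtain ⟨c, rfl⟩ := (Ideal.mem_span_range_iff_exists_fun).1 hf'
  have : truncMk (2 ^ n) (∑ j, c j * X j ^ 1) ^ 2 ^ n = 0 := by
    rw [← map_pow, sum_pow_char_pow 2 n, map_sum]
    refine Finset.sum_eq_zero fun j _ ↦ ?_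
    rw [pow_one, mul_pow, map_mul, map_pow _ (X j), truncMk_X_pow, mul_zero]
  ext x
  rw [truncMul_pow_apply, this, zero_mul, LinearMap.zero_apply]

/-- The quotient is the cokernel of multiplication by f on a finite-dimensional space, so it has the
dimension of the kernel. -/
theorem hkFunction_eq_kerDim (f : MvPowerSeries σ F) (n : ℕ) :
    hkFunction f n = kerDim (truncMul (2 ^ n) f) 1 := by
  have e1 : Ideal.span (Set.range (fun j : σ ↦ (X j : MvPowerSeries σ F) ^ 2 ^ n) ∪ {f}) =
      truncIdeal F σ (2 ^ n) ⊔ Ideal.span {f} := Ideal.span_union _ _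
  let J := (Ideal.span {f}).map (Ideal.Quotient.mkₐ F (truncIdeal F σ (2 ^ n)))
  have e2 : J.restrictScalars F = LinearMap.range (truncMul (2 ^ n) f) := by
    ext x
    simp only [J, Ideal.map_span, Set.image_singleton, Submodule.restrictScalars_mem,
      Ideal.mem_span_singleton]
    exact ⟨fun ⟨y, hy⟩ ↦ ⟨y, hy.symm⟩, fun ⟨y, hy⟩ ↦ ⟨y, hy.symm⟩⟩
  have e3 := (DoubleQuot.quotQuotEquivQuotSupₐ F (truncIdeal F σ (2 ^ n))
    (Ideal.span {f})).toLinearEquiv.finrank_eq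
  have e4 := (Submodule.Quotient.restrictScalarsEquiv F J).finrank_eq
  have : Module.Finite F (MvPowerSeries σ F ⧸ truncIdeal F σ (2 ^ n)) :=
    inferInstanceAs (Module.Finite F (TruncAlg F σ (2 ^ n)))
  have e5 := Submodule.finrank_quotient_add_finrank (J.restrictScalars F)
  have e6 := LinearMap.finrank_range_add_finrank_ker (truncMul (2 ^ n) f)
  rw [hkFunction, e1, kerDim, pow_one, ← e3]
  rw [← e2] at e6
  exact Nat.add_right_cancel ((congrArg (· + _) e4.symm).trans (e5.trans (e6.symm.trans (add_comm _ _))))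

theorem truncMul_rename_equiv (q : ℕ) (e : σ ≃ τ) (f : MvPowerSeries σ F) :
    ∃ E : TruncAlg F σ q ≃ₗ[F] TruncAlg F τ q,
      ∀ x, E (truncMul q f x) = truncMul q (rename e f) (E x) := by
  have h₁ (x : TruncAlg F τ q) :
      truncMap q e.toEmbedding (truncMap q e.symm.toEmbedding x) = x := by
    obtain ⟨f, rfl⟩ := truncMk_surjective q x
    rw [truncMap_truncMk, truncMap_truncMk, rename_rename]
    simp
  have h₂ (x : TruncAlg F σ q) :
      truncMap q e.symm.toEmbedding (truncMap q e.toEmbedding x) = x := by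
    obtain ⟨f, rfl⟩ := truncMk_surjective q x
    rw [truncMap_truncMk, truncMap_truncMk, rename_rename]
    simp
  refine ⟨LinearEquiv.ofLinearMap (truncMap q e.toEmbedding).toLinearMap
    (truncMap q e.symm.toEmbedding).toLinearMap (LinearMap.ext h₁) (LinearMap.ext h₂), fun x ↦ ?_⟩
  exact map_mul (truncMap q e.toEmbedding) _ _

variable (F σ τ) in
theorem exists_truncAlg_tensor_equiv (q : ℕ) :
    ∃ E : TruncAlg F σ q ⊗[F] TruncAlg F τ q ≃ₗ[F] TruncAlg F (σ ⊕ τ) q,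
      ∀ x y, E (x ⊗ₜ y) =
        truncMap q Function.Embedding.inl x * truncMap q Function.Embedding.inr y := by
  let φ : TruncAlg F σ q ⊗[F] TruncAlg F τ q →ₐ[F] TruncAlg F (σ ⊕ τ) q :=
    Algebra.TensorProduct.productMap (truncMap q Function.Embedding.inl)
      (truncMap q Function.Embedding.inr)
  let E := ((truncBasis F σ q).tensorProduct (truncBasis F τ q)).equiv (truncBasis F (σ ⊕ τ) q)
    (Equiv.sumArrowEquivProdArrow σ τ (Fin q)).symm
  have h : E.toLinearMap = φ.toLinearMap := by
    refine ((truncBasis F σ q).tensorProduct (truncBasis F τ q)).ext fun ⟨a, b⟩ ↦ ?_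
    rw [LinearEquiv.coe_coe, Module.Basis.equiv_apply]
    simp only [AlgHom.toLinearMap_apply,
      Module.Basis.tensorProduct_apply, truncBasis_apply, φ,
      Algebra.TensorProduct.productMap_apply_tmul, truncMonomial, truncMap_truncMk, ← map_mul]
    congr 1
    simp [Fintype.prod_sum_type, map_prod]
  exact ⟨E, fun x y ↦ (LinearMap.congr_fun h (x ⊗ₜ y)).trans
    (Algebra.TensorProduct.productMap_apply_tmul _ _ _ _)⟩

theorem truncMul_sum_equiv (q : ℕ) (f : MvPowerSeries σ F) (g : MvPowerSeries τ F) :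
    ∃ E : TruncAlg F σ q ⊗[F] TruncAlg F τ q ≃ₗ[F] TruncAlg F (σ ⊕ τ) q,
      ∀ x, E (tensorSum (truncMul q f) (truncMul q g) x) =
        truncMul q (rename Function.Embedding.inl f + rename Function.Embedding.inr g) (E x) := by
  obtain ⟨E, hE⟩ := exists_truncAlg_tensor_equiv F σ τ q
  refine ⟨E, fun x ↦ ?_⟩
  induction x with
  | zero => simp
  | add x y hx hy => simp only [map_add, hx, hy]
  | tmul x y =>
    simp only [tensorSum_tmul, map_add, hE, truncMul_apply, map_mul, truncMap_truncMk]
    ring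

end MvPowerSeries

/-! ### The kernel of T ⊗ 1 + 1 ⊗ S for a diagonal shift S -/

section Shift

variable {F : Type*} [Field F] {M : Type*} [AddCommGroup M] [Module F M]

/-- Arrays `m a b` of vectors, zero for `a ≥ q` or `b ≥ q`, with `T (m a b) + m (a+1) (b+1) = 0`. -/
def diagonalArrays (T : Module.End F M) (q : ℕ) : Submodule F (ℕ → ℕ → M) where
  carrier := {m | (∀ a b, T (m a b) + m (a + 1) (b + 1) = 0) ∧
    ∀ a b, (q ≤ a ∨ q ≤ b) → m a b = 0}
  zero_mem' := by simp
  add_mem' := by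
    rintro m m' ⟨h₁, h₂⟩ ⟨h₁', h₂'⟩
    refine ⟨fun a b ↦ ?_, fun a b h ↦ ?_⟩
    · simp only [Pi.add_apply, map_add]
      rw [add_add_add_comm, h₁, h₁', add_zero]
    · simp [h₂ a b h, h₂' a b h]
  smul_mem' := by
    rintro c m ⟨h₁, h₂⟩
    refine ⟨fun a b ↦ ?_, fun a b h ↦ ?_⟩
    · simp only [Pi.smul_apply, map_smul]
      rw [← smul_add, h₁, smul_zero]
    · simp [h₂ a b h]

theorem diagonalArrays_apply {T : Module.End F M} {q : ℕ} {m : ℕ → ℕ → M}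
    (hm : m ∈ diagonalArrays T q) (k a b : ℕ) : m (a + k) (b + k) = ((-T) ^ k) (m a b) := by
  induction k with
  | zero => simp
  | succ k ih =>
    rw [pow_succ', Module.End.mul_apply, ← ih, LinearMap.neg_apply, ← add_assoc, ← add_assoc]
    exact (neg_eq_of_add_eq_zero_right (hm.1 _ _)).symm

theorem ker_neg_pow (T : Module.End F M) (k : ℕ) (x : M) :
    ((-T) ^ k) x = 0 ↔ (T ^ k) x = 0 := by
  rcases Nat.even_or_odd k with h | h
  · rw [h.neg_pow]
  · rw [h.neg_pow, LinearMap.neg_apply, neg_eq_zero]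

/-- An array is determined along each diagonal by its entry on the edge a = 0 or b = 0. That entry
is free, subject to being killed by the power of T at which the diagonal leaves the square. -/
theorem finrank_diagonalArrays [FiniteDimensional F M] (T : Module.End F M) (q : ℕ) :
    Module.finrank F (diagonalArrays T q) =
      ∑ j ∈ Finset.range q, (kerDim T j + kerDim T (j + 1)) := by
  -- The second family starts at column 1, as the corner is already in the first; its last factor,
  -- at column q, is ker T^0 = 0.
  let φ : diagonalArrays T q →ₗ[F] ((∀ a : Fin q, LinearMap.ker (T ^ (q - a))) ×
      (∀ b : Fin q, LinearMap.ker (T ^ (q - 1 - b)))) :=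
    { toFun := fun m ↦ (fun a ↦ ⟨m.1 a 0, by
          rw [LinearMap.mem_ker, ← ker_neg_pow, ← diagonalArrays_apply m.2]
          exact m.2.2 _ _ (by omega)⟩,
        fun b ↦ ⟨m.1 0 (b + 1), by
          rw [LinearMap.mem_ker, ← ker_neg_pow, ← diagonalArrays_apply m.2]
          exact m.2.2 _ _ (by omega)⟩)
      map_add' := fun _ _ ↦ rfl
      map_smul' := fun _ _ ↦ rfl }
  have hinj : Function.Injective φ := by
    rw [← LinearMap.ker_eq_bot, LinearMap.ker_eq_bot']
    intro m hm
    have h₁ (a : ℕ) : m.1 a 0 = 0 := by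
      by_cases ha : a < q
      · exact congrArg Subtype.val (congrFun (congrArg Prod.fst hm) ⟨a, ha⟩)
      · exact m.2.2 _ _ (by omega)
    have h₂ (b : ℕ) : m.1 0 (b + 1) = 0 := by
      by_cases hb : b < q
      · exact congrArg Subtype.val (congrFun (congrArg Prod.snd hm) ⟨b, hb⟩)
      · exact m.2.2 _ _ (by omega)
    refine Subtype.ext (funext fun a ↦ funext fun b ↦ ?_)
    change m.1 a b = 0
    rcases le_or_gt b a with h | h
    · have := diagonalArrays_apply m.2 b (a - b) 0
      rw [h₁, map_zero, Nat.sub_add_cancel h, zero_add] at this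
      exact this
    · have := diagonalArrays_apply m.2 a 0 (b - a - 1 + 1)
      rw [h₂, map_zero, zero_add, show b - a - 1 + 1 + a = b by omega] at this
      exact this
  have hsurj : Function.Surjective φ := by
    rintro ⟨x, y⟩
    let x' (a : ℕ) : M := if h : a < q then x ⟨a, h⟩ else 0
    let y' (b : ℕ) : M := if h : b < q then y ⟨b, h⟩ else 0
    let m (a b : ℕ) : M := if b ≤ a then ((-T) ^ b) (x' (a - b)) else ((-T) ^ a) (y' (b - a - 1))
    have hm : m ∈ diagonalArrays T q := by
      refine ⟨fun a b ↦ ?_, fun a b h ↦ ?_⟩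
      · simp only [m, add_le_add_iff_right, Nat.add_sub_add_right]
        split_ifs
        all_goals
          rw [pow_succ', Module.End.mul_apply, LinearMap.neg_apply, add_neg_cancel]
      · simp only [m]
        split_ifs with hab
        · simp only [x']
          split_ifs with hlt
          · rw [ker_neg_pow]
            exact Module.End.pow_map_zero_of_le (show q - (a - b) ≤ b by omega) (x ⟨a - b, hlt⟩).2
          · rw [map_zero]
        · simp only [y']
          split_ifs with hlt
          · rw [ker_neg_pow]
            exact Module.End.pow_map_zero_of_le (show q - 1 - (b - a - 1) ≤ a by omega)
              (y ⟨b - a - 1, hlt⟩).2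
          · rw [map_zero]
    refine ⟨⟨m, hm⟩, Prod.ext (funext fun a ↦ Subtype.ext ?_) (funext fun b ↦ Subtype.ext ?_)⟩
    · change m a 0 = x a
      simp [m, x']
    · change m 0 (b + 1) = y b
      simp [m, y']
  rw [(LinearEquiv.ofBijective φ ⟨hinj, hsurj⟩).finrank_eq, Module.finrank_prod,
    Module.finrank_pi_fintype, Module.finrank_pi_fintype]
  change ∑ a : Fin q, kerDim T (q - a) + ∑ b : Fin q, kerDim T (q - 1 - b) = _
  rw [Fin.sum_univ_eq_sum_range (fun a ↦ kerDim T (q - a)),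
    Fin.sum_univ_eq_sum_range (fun b ↦ kerDim T (q - 1 - b)), Finset.sum_range_reflect (kerDim T),
    add_comm, Finset.sum_add_distrib, ← Finset.sum_range_reflect (fun j ↦ kerDim T (j + 1))]
  congr 1
  refine Finset.sum_congr rfl fun j hj ↦ ?_
  have := Finset.mem_range.1 hj
  congr 1
  omega

theorem kerDim_tensorSum_shift [FiniteDimensional F M] {N : Type*} [AddCommGroup N] [Module F N]
    (T : Module.End F M) (S : Module.End F N) (q : ℕ) (B : Module.Basis (Fin q × Fin q) F N)
    (hS : ∀ y a b, B.repr (S y) (a, b) =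
      if h : (a : ℕ) + 1 < q ∧ (b : ℕ) + 1 < q then B.repr y (⟨a + 1, h.1⟩, ⟨b + 1, h.2⟩) else 0) :
    kerDim (tensorSum T S) 1 = ∑ j ∈ Finset.range q, (kerDim T j + kerDim T (j + 1)) := by
  rw [← finrank_diagonalArrays]
  let E := TensorProduct.equivFinsuppOfBasisRight (M := M) B
  have hE (z : M ⊗[F] N) (a b : Fin q) : E (tensorSum T S z) (a, b) = T (E z (a, b)) +
      if h : (a : ℕ) + 1 < q ∧ (b : ℕ) + 1 < q then E z (⟨a + 1, h.1⟩, ⟨b + 1, h.2⟩) else 0 := by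
    induction z with
    | zero => simp
    | add x y hx hy =>
      simp only [map_add, Finsupp.add_apply, hx, hy]
      split_ifs
      · abel
      · simp
    | tmul x y =>
      simp only [tensorSum_tmul, map_add, Finsupp.add_apply, E,
        TensorProduct.equivFinsuppOfBasisRight_apply_tmul_apply, hS, map_smul]
      split_ifs <;> simp
  let ψ : (M ⊗[F] N) →ₗ[F] (ℕ → ℕ → M) :=
    { toFun := fun z a b ↦ if h : a < q ∧ b < q then E z (⟨a, h.1⟩, ⟨b, h.2⟩) else 0
      map_add' := fun x y ↦ by
        ext a b
        simp only [map_add, Finsupp.add_apply, Pi.add_apply]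
        split_ifs <;> simp
      map_smul' := fun c x ↦ by
        ext a b
        simp only [map_smul, Finsupp.smul_apply, Pi.smul_apply, RingHom.id_apply]
        split_ifs <;> simp }
  have hψ (z : M ⊗[F] N) (a b : ℕ) :
      ψ z a b = if h : a < q ∧ b < q then E z (⟨a, h.1⟩, ⟨b, h.2⟩) else 0 := rfl
  have hinj : Function.Injective ψ := by
    rw [← LinearMap.ker_eq_bot, LinearMap.ker_eq_bot']
    intro z hz
    refine E.map_eq_zero_iff.1 (Finsupp.ext fun ⟨a, b⟩ ↦ ?_)
    have := congrFun (congrFun hz a) b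
    rwa [hψ, dif_pos ⟨a.2, b.2⟩] at this
  have hker : (LinearMap.ker (tensorSum T S ^ 1)).map ψ = diagonalArrays T q := by
    ext m
    constructor
    · rintro ⟨z, hz, rfl⟩
      rw [pow_one] at hz
      have hz : tensorSum T S z = 0 := hz
      refine ⟨fun a b ↦ ?_, fun a b h ↦ by rw [hψ, dif_neg (by omega)]⟩
      by_cases hab : a < q ∧ b < q
      · have := hE z ⟨a, hab.1⟩ ⟨b, hab.2⟩
        rw [hz, map_zero] at this
        rw [hψ, hψ, dif_pos hab]
        exact this.symm
      · rw [hψ, hψ, dif_neg hab, dif_neg (by omega), map_zero, add_zero]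
    · intro hm
      let z := E.symm (Finsupp.equivFunOnFinite.symm fun p ↦ m p.1 p.2)
      have hz (a b : Fin q) : E z (a, b) = m a b := by simp [z]
      refine ⟨z, ?_, ?_⟩
      · rw [pow_one]
        refine E.map_eq_zero_iff.1 (Finsupp.ext fun ⟨a, b⟩ ↦ ?_)
        rw [hE, hz, Finsupp.zero_apply]
        refine Eq.trans ?_ (hm.1 a b)
        congr 1
        split_ifs with h
        · exact hz _ _
        · exact (hm.2 (a + 1) (b + 1) (by omega)).symm
      · ext a b
        rw [hψ]
        split_ifs with h
        · exact hz _ _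
        · exact (hm.2 a b (by omega)).symm
  rw [← hker, kerDim]
  exact (LinearEquiv.finrank_eq (Submodule.equivMapOfInjective ψ hinj _))

end Shift

/-! ### The Hilbert–Kunz function of uv + g -/

namespace MvPowerSeries

variable {F : Type*} [Field F] {σ : Type*} [Fintype σ]

theorem hkFunction_uvAdd (g : MvPowerSeries σ F) (n : ℕ) :
    hkFunction (uvAdd g) n = ∑ j ∈ Finset.range (2 ^ n),
      (kerDim (truncMul (2 ^ n) g) j + kerDim (truncMul (2 ^ n) g) (j + 1)) := by
  let f : MvPowerSeries (Fin 2) F := X 0 * X 1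
  have hf : uvAdd g = rename Function.Embedding.inl g + rename Function.Embedding.inr f := by
    rw [uvAdd, add_comm]
    simp [f]
  obtain ⟨E, hE⟩ := truncMul_sum_equiv (2 ^ n) g f
  rw [hkFunction_eq_kerDim, hf, ← kerDim_congr E hE]
  let q := 2 ^ n
  -- Exponents are reversed, so that multiplication by uv lowers both indices, as the shift lemma
  -- requires.
  let B := (truncBasis F (Fin 2) q).reindex
    ((finTwoArrowEquiv (Fin q)).trans (Equiv.prodCongr Fin.revPerm Fin.revPerm))
  have hB (a b : Fin q) : B (a, b) = truncMonomial q ![a.rev, b.rev] := by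
    rw [Module.Basis.reindex_apply, truncBasis_apply]
    congr 1
    ext j
    fin_cases j <;> simp
  refine kerDim_tensorSum_shift _ _ q B fun y a b ↦ ?_
  have hSB (a b : Fin q) : truncMul q f (B (a, b)) =
      if h : 0 < (a : ℕ) ∧ 0 < (b : ℕ) then B (⟨a - 1, by omega⟩, ⟨b - 1, by omega⟩) else 0 := by
    have h1 : truncMk q f = truncMonomial q ![1, 1] := by
      simp [truncMonomial, f]
    rw [truncMul_apply, hB, h1, ← truncMonomial_add]
    split_ifs with h
    · rw [hB]
      congr 1
      ext j
      fin_cases j <;> simp [Fin.val_rev] <;> omega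
    · rcases not_and_or.1 h with h | h
      · exact truncMonomial_eq_zero (j := 0) (by simp [Fin.val_rev]; omega)
      · exact truncMonomial_eq_zero (j := 1) (by simp [Fin.val_rev]; omega)
  have hy : y ∈ Submodule.span F (Set.range B) := by rw [B.span_eq]; trivial
  induction hy using Submodule.span_induction with
  | zero => simp
  | add x y _ _ hx hy =>
    simp only [map_add, Finsupp.add_apply, hx, hy]
    split_ifs <;> simp
  | smul c x _ hx =>
    simp only [map_smul, Finsupp.smul_apply, hx]
    split_ifs <;> simp
  | mem y hy =>
    obtain ⟨⟨c, d⟩, rfl⟩ := hy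
    rw [hSB]
    split_ifs with h₁ h₂ h₂
    · simp only [Module.Basis.repr_self, Finsupp.single_apply, Prod.mk.injEq, Fin.ext_iff]
      congr 1
      rw [eq_iff_iff]
      omega
    · rw [Module.Basis.repr_self, Finsupp.single_apply, if_neg]
      simp only [Prod.mk.injEq, Fin.ext_iff]
      omega
    · rw [map_zero, Finsupp.zero_apply, Module.Basis.repr_self, Finsupp.single_apply, if_neg]
      simp only [Prod.mk.injEq, Fin.ext_iff]
      omega
    · simp

end MvPowerSeries

/-! ### Frobenius and the coefficients of θ -/

namespace MvPowerSeries

variable {F : Type*} [Field F] [CharP F 2] {σ : Type*}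

instance : CharP (MvPowerSeries σ F) 2 :=
  charP_of_injective_algebraMap (algebraMap F _).injective 2

variable (F σ) in
/-- The squaring map `F[[σ]] / (xⱼ ^ q) → F[[σ]] / (xⱼ ^ (2 * q))`. -/
def truncSquare [Finite σ] (q : ℕ) : TruncAlg F σ q →+* TruncAlg F σ (2 * q) :=
  Ideal.Quotient.lift _ ((truncMk (2 * q)).toRingHom.comp (frobenius _ 2)) fun f hf ↦ by
    have := Fintype.ofFinite σ
    obtain ⟨c, rfl⟩ := (Ideal.mem_span_range_iff_exists_fun).1 hf
    rw [map_sum]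
    refine Finset.sum_eq_zero fun j _ ↦ ?_
    change truncMk (2 * q) ((c j * X j ^ q) ^ 2) = 0
    rw [mul_pow, ← pow_mul, mul_comm q, map_mul, map_pow _ (X j), truncMk_X_pow, mul_zero]

variable [Fintype σ]

theorem truncSquare_truncMk (q : ℕ) (f : MvPowerSeries σ F) :
    truncSquare F σ q (truncMk q f) = truncMk (2 * q) f ^ 2 :=
  map_pow (truncMk (2 * q)) f 2

theorem truncSquare_smul (q : ℕ) (c : F) (x : TruncAlg F σ q) :
    truncSquare F σ q (c • x) = c ^ 2 • truncSquare F σ q x := by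
  obtain ⟨f, rfl⟩ := truncMk_surjective q x
  rw [← map_smul, truncSquare_truncMk, truncSquare_truncMk, map_smul, smul_pow]

theorem truncSquare_mem_span (q : ℕ) {ι : Type*} (v : ι → TruncAlg F σ q) {x : TruncAlg F σ q}
    (hx : x ∈ Submodule.span F (Set.range v)) (ε : σ → Fin 2) :
    truncMonomial (2 * q) (fun j ↦ (ε j : ℕ)) * truncSquare F σ q x ∈
      Submodule.span F (Set.range fun p : (σ → Fin 2) × ι ↦
        truncMonomial (2 * q) (fun j ↦ (p.1 j : ℕ)) * truncSquare F σ q (v p.2)) := by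
  induction hx using Submodule.span_induction with
  | zero => simp
  | add x y _ _ hx hy =>
    rw [map_add, mul_add]
    exact add_mem hx hy
  | smul c x _ hx =>
    rw [truncSquare_smul, mul_smul_comm]
    exact Submodule.smul_mem _ _ hx
  | mem x hx =>
    obtain ⟨i, rfl⟩ := hx
    exact Submodule.subset_span ⟨(ε, i), rfl⟩

/-- Each monomial is x^ε times the square of a monomial, by splitting exponents modulo 2. Squaring a
linear combination squares its coefficients, so `F` need not be perfect. -/
theorem top_le_span_truncSquare (q : ℕ) {ι : Type*} (b : Module.Basis ι F (TruncAlg F σ q)) :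
    ⊤ ≤ Submodule.span F (Set.range fun p : (σ → Fin 2) × ι ↦
        truncMonomial (2 * q) (fun j ↦ (p.1 j : ℕ)) * truncSquare F σ q (b p.2)) := by
  rw [← (truncBasis F σ (2 * q)).span_eq, Submodule.span_le]
  rintro _ ⟨a, rfl⟩
  have := truncSquare_mem_span q b (x := truncMonomial q fun j ↦ (a j : ℕ) / 2)
    (by rw [b.span_eq]; trivial) (fun j ↦ ⟨(a j : ℕ) % 2, Nat.mod_lt _ two_pos⟩)
  have h : truncSquare F σ q (truncMonomial q fun j ↦ (a j : ℕ) / 2) =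
      truncMonomial (2 * q) (fun j ↦ (a j : ℕ) / 2) ^ 2 :=
    truncSquare_truncMk q _
  rw [h, truncMonomial_pow, ← truncMonomial_add] at this
  have ha : ((fun j ↦ (a j : ℕ) % 2) + 2 • fun j ↦ (a j : ℕ) / 2) = fun j ↦ (a j : ℕ) :=
    funext fun j ↦ Nat.mod_add_div _ _
  rwa [truncBasis_apply, ← ha]

theorem linearIndependent_truncSquare (q : ℕ) {ι : Type*} [Fintype ι]
    (b : Module.Basis ι F (TruncAlg F σ q)) :
    LinearIndependent F fun p : (σ → Fin 2) × ι ↦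
        truncMonomial (2 * q) (fun j ↦ (p.1 j : ℕ)) * truncSquare F σ q (b p.2) := by
  classical
  refine linearIndependent_of_top_le_span_of_card_eq_finrank (top_le_span_truncSquare q b) ?_
  rw [Fintype.card_prod, ← Module.finrank_eq_card_basis b, finrank_truncAlg, finrank_truncAlg,
    Fintype.card_fun, Fintype.card_fin, mul_pow]

theorem truncMul_pow_truncSquare (q : ℕ) (f : MvPowerSeries σ F) (j : ℕ)
    (y : TruncAlg F σ (2 * q)) (x : TruncAlg F σ q) :
    (truncMul (2 * q) f ^ (2 * j)) (y * truncSquare F σ q x) =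
      y * truncSquare F σ q ((truncMul q f ^ j) x) := by
  rw [truncMul_pow_apply, truncMul_pow_apply, map_mul, map_pow, truncSquare_truncMk, pow_mul]
  ring

/-- f^(2j) x^ε y² = x^ε (f^j y)², so with a basis of A_q extending one of the image of f^j, the
image of f^(2j) has the basis x^ε b². -/
theorem finrank_range_truncMul_pow (q : ℕ) (f : MvPowerSeries σ F) (j : ℕ) :
    Module.finrank F (LinearMap.range (truncMul (2 * q) f ^ (2 * j))) =
      2 ^ Fintype.card σ * Module.finrank F (LinearMap.range (truncMul q f ^ j)) := by
  classical
  let W := LinearMap.range (truncMul q f ^ j)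
  obtain ⟨W', hW⟩ := W.exists_isCompl
  let bW := Module.finBasis F W
  let b := (bW.prod (Module.finBasis F W')).map (Submodule.prodEquivOfIsCompl W W' hW)
  have hb (i) : b (Sum.inl i) = bW i := by simp [b]
  let v (p : (σ → Fin 2) × Fin (Module.finrank F W)) : TruncAlg F σ (2 * q) :=
    truncMonomial (2 * q) (fun j ↦ (p.1 j : ℕ)) * truncSquare F σ q (bW p.2)
  have hv : LinearIndependent F v := by
    have := (linearIndependent_truncSquare q b).comp (Prod.map id Sum.inl)
      (Function.injective_id.prodMap Sum.inl_injective)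
    simpa only [Function.comp_def, Prod.map, hb, id] using this
  have hspan : LinearMap.range (truncMul (2 * q) f ^ (2 * j)) = Submodule.span F (Set.range v) := by
    refine le_antisymm ?_ ?_
    · rw [LinearMap.range_eq_map, ← top_le_iff.1 (top_le_span_truncSquare q b),
        Submodule.map_span, Submodule.span_le]
      rintro _ ⟨_, ⟨p, rfl⟩, rfl⟩
      simp only [truncMul_pow_truncSquare]
      refine truncSquare_mem_span q (fun i ↦ (bW i : TruncAlg F σ q)) ?_ p.1
      have h₁ : (truncMul q f ^ j) (b p.2) ∈ W := ⟨_, rfl⟩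
      have h₂ := congrArg (Submodule.map W.subtype) bW.span_eq
      rw [Submodule.map_span, Submodule.map_subtype_top, ← Set.range_comp] at h₂
      exact h₂.symm ▸ h₁
    · rw [Submodule.span_le]
      rintro _ ⟨p, rfl⟩
      obtain ⟨y, hy⟩ := (bW p.2).2
      exact ⟨truncMonomial (2 * q) (fun j ↦ (p.1 j : ℕ)) * truncSquare F σ q y, by
        rw [truncMul_pow_truncSquare, hy]⟩
  rw [hspan, finrank_span_eq_card hv, Fintype.card_prod, Fintype.card_fun, Fintype.card_fin,
    Fintype.card_fin]

theorem kerDim_truncMul_two_mul (q : ℕ) (f : MvPowerSeries σ F) (j : ℕ) :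
    kerDim (truncMul (2 * q) f) (2 * j) = 2 ^ Fintype.card σ * kerDim (truncMul q f) j := by
  have h₁ := LinearMap.finrank_range_add_finrank_ker (truncMul (2 * q) f ^ (2 * j))
  have h₂ := LinearMap.finrank_range_add_finrank_ker (truncMul q f ^ j)
  rw [finrank_truncAlg] at h₁ h₂
  rw [finrank_range_truncMul_pow, mul_pow, ← h₂, mul_add] at h₁
  exact Nat.add_left_cancel h₁

theorem coeff_theta (g : MvPowerSeries σ F) (n : ℕ) :
    PowerSeries.coeff n (theta g) = oddBlocks (truncMul (2 ^ n) g) (2 ^ n) := by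
  rw [theta, sub_mul, one_mul, map_sub, mul_assoc, PowerSeries.coeff_C_mul, PowerSeries.coeff_mk]
  cases n with
  | zero =>
    rw [PowerSeries.coeff_zero_X_mul, mul_zero, sub_zero, hkFunction_uvAdd]
    simp [oddBlocks, kerDim_zero]
  | succ n =>
    rw [PowerSeries.coeff_succ_X_mul, PowerSeries.coeff_mk, hkFunction_uvAdd, hkFunction_uvAdd,
      oddBlocks]
    -- Pairing indices 2j and 2j + 1 leaves -k_{2j} + 2k_{2j+1} - k_{2j+2} on both sides.
    have hsum (u : ℕ → ℤ) (h : ℕ) : ∑ j ∈ Finset.range (2 * h), u j =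
        ∑ j ∈ Finset.range h, (u (2 * j) + u (2 * j + 1)) := by
      induction h with
      | zero => simp
      | succ h ih =>
        rw [Finset.sum_range_succ, ← ih, mul_add, mul_one, Finset.sum_range_succ,
          Finset.sum_range_succ, add_assoc]
    have hk (j : ℕ) : (2 : ℤ) ^ (Fintype.card σ + 1) * kerDim (truncMul (2 ^ n) g) j =
        2 * kerDim (truncMul (2 * 2 ^ n) g) (2 * j) := by
      rw [kerDim_truncMul_two_mul]
      push_cast
      ring
    rw [pow_succ 2 n, mul_comm (2 ^ n) 2]
    push_cast
    rw [hsum, hsum, Finset.mul_sum, ← Finset.sum_sub_distrib]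
    refine Finset.sum_congr rfl fun j _ ↦ ?_
    rw [mul_add, hk, hk, pow_succ, (even_two_mul j).neg_one_pow,
      show 2 * j + 1 + 1 = 2 * (j + 1) by ring]
    ring

end MvPowerSeries

/-! ### Disjoint sums and the telescoping of ratios -/

namespace MvPowerSeries

theorem oddBlocks_rename_equiv {F : Type*} [Field F] {σ τ : Type*} [Fintype σ] [Fintype τ]
    (q : ℕ) (e : σ ≃ τ) (f : MvPowerSeries σ F) :
    oddBlocks (truncMul q (rename e f)) q = oddBlocks (truncMul q f) q := by
  obtain ⟨E, hE⟩ := truncMul_rename_equiv q e f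
  exact (oddBlocks_congr E hE q).symm

theorem oddBlocks_truncMul_add {F : Type*} [Field F] [CharP F 2] {σ τ : Type*} [Fintype σ]
    [Fintype τ] (n : ℕ) {f : MvPowerSeries σ F} {g : MvPowerSeries τ F}
    (hf : constantCoeff f = 0) (hg : constantCoeff g = 0) :
    oddBlocks (truncMul (2 ^ n)
        (rename Function.Embedding.inl f + rename Function.Embedding.inr g)) (2 ^ n) =
      oddBlocks (truncMul (2 ^ n) f) (2 ^ n) * oddBlocks (truncMul (2 ^ n) g) (2 ^ n) := by
  obtain ⟨E, hE⟩ := truncMul_sum_equiv (2 ^ n) f g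
  rw [← oddBlocks_congr E hE]
  exact (oddBlocks_tensorSum_and_nonneg n (truncMul_pow_two_pow n hf)
    (truncMul_pow_two_pow n hg)).1

theorem oddBlocks_truncMul_nonneg {F : Type*} [Field F] [CharP F 2] {σ : Type*} [Fintype σ]
    (n : ℕ) {f : MvPowerSeries σ F} (hf : constantCoeff f = 0) :
    0 ≤ oddBlocks (truncMul (2 ^ n) f) (2 ^ n) :=
  (oddBlocks_tensorSum_and_nonneg n (truncMul_pow_two_pow n hf)
    (truncMul_pow_two_pow n hf)).2

theorem constantCoeff_disjointSum {F : Type*} [Field F] {ι : Type*} [Fintype ι] {σ : ι → Type*}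
    {g : ∀ i, MvPowerSeries (σ i) F} (hg : ∀ i, constantCoeff (g i) = 0) :
    constantCoeff (disjointSum g) = 0 := by
  rw [disjointSum, map_sum]
  exact Finset.sum_eq_zero fun i _ ↦ by rw [constantCoeff_rename, hg]

theorem oddBlocks_zero {F : Type*} [Field F] [CharP F 2] {σ : Type*} [Fintype σ] [IsEmpty σ]
    (n : ℕ) : oddBlocks (truncMul (F := F) (σ := σ) (2 ^ n) 0) (2 ^ n) = 1 := by
  have h : truncMul (F := F) (σ := σ) (2 ^ n) 0 = 0 := by
    ext x
    rw [truncMul_apply, map_zero, zero_mul, LinearMap.zero_apply]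
  rw [h, oddBlocks, Finset.sum_eq_single 0]
  · rw [kerDim_zero, kerDim_of_pow_eq_zero (by simp), finrank_truncAlg]
    simp
  · intro j _ hj
    rw [kerDim_of_pow_eq_zero (zero_pow hj), kerDim_of_pow_eq_zero (zero_pow (Nat.succ_ne_zero j)),
      sub_self, mul_zero]
  · simp

/-- Induction on the index type: relabelling variables changes nothing, the empty sum acts as 0 on
the line F, and one more summand is the two-term case. -/
theorem oddBlocks_disjointSum {F : Type*} [Field F] [CharP F 2] {ι : Type*} [Fintype ι] (n : ℕ) :
    ∀ {σ : ι → Type v} [∀ i, Fintype (σ i)] (g : ∀ i, MvPowerSeries (σ i) F),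
      (∀ i, constantCoeff (g i) = 0) →
      oddBlocks (truncMul (2 ^ n) (disjointSum g)) (2 ^ n) =
        ∏ i, oddBlocks (truncMul (2 ^ n) (g i)) (2 ^ n) := by
  refine Fintype.induction_empty_option (P := fun ι _ ↦
    ∀ {σ : ι → Type v} [∀ i, Fintype (σ i)] (g : ∀ i, MvPowerSeries (σ i) F),
      (∀ i, constantCoeff (g i) = 0) →
      oddBlocks (truncMul (2 ^ n) (disjointSum g)) (2 ^ n) =
        ∏ i, oddBlocks (truncMul (2 ^ n) (g i)) (2 ^ n)) ?_ ?_ ?_ ι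
  · intro α β _ e ih σ _ g hg
    have := Fintype.ofEquiv β e.symm
    have h : disjointSum g =
        rename (Equiv.sigmaCongrLeft e) (disjointSum fun a ↦ g (e a)) := by
      rw [disjointSum, disjointSum, map_sum, ← e.sum_comp]
      refine Finset.sum_congr rfl fun a _ ↦ ?_
      rw [rename_rename]
      rfl
    have h' := ih (fun a ↦ g (e a)) fun a ↦ hg _
    rw [h, oddBlocks_rename_equiv, ← e.prod_comp]
    convert h'
  · intro σ _ g _
    have h : disjointSum g = 0 := by
      rw [disjointSum, Finset.univ_eq_empty, Finset.sum_empty]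
    rw [h, oddBlocks_zero, Finset.univ_eq_empty, Finset.prod_empty]
  · intro α _ ih σ _ g hg
    let e : σ none ⊕ (Σ a : α, σ (some a)) ≃ Σ i : Option α, σ i :=
      { toFun := Sum.elim (fun x ↦ ⟨none, x⟩) fun p ↦ ⟨some p.1, p.2⟩
        invFun := fun p ↦ match p with
          | ⟨none, x⟩ => Sum.inl x
          | ⟨some a, x⟩ => Sum.inr ⟨a, x⟩
        left_inv := by rintro (x | ⟨a, x⟩) <;> rfl
        right_inv := by rintro ⟨_ | a, x⟩ <;> rfl }
    have h : disjointSum g = rename e (rename Function.Embedding.inl (g none) +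
        rename Function.Embedding.inr (disjointSum fun a ↦ g (some a))) := by
      rw [disjointSum, Fintype.sum_option, map_add, rename_rename, rename_rename, disjointSum,
        map_sum]
      congr 1
      refine Finset.sum_congr rfl fun a _ ↦ ?_
      rw [rename_rename]
      rfl
    rw [h, oddBlocks_rename_equiv,
      oddBlocks_truncMul_add n (hg none) (constantCoeff_disjointSum fun a ↦ hg (some a)),
      ih (fun a ↦ g (some a)) fun a ↦ hg (some a), Fintype.prod_option]

theorem hkFunction_uvAdd_le {F : Type*} [Field F] {σ : Type*} [Fintype σ] (g : MvPowerSeries σ F)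
    (n : ℕ) : hkFunction (uvAdd g) n ≤ 2 * (2 ^ n) ^ (Fintype.card σ + 1) := by
  have h (j : ℕ) : kerDim (truncMul (2 ^ n) g) j ≤ (2 ^ n) ^ Fintype.card σ :=
    (kerDim_le _ _).trans (finrank_truncAlg F σ (2 ^ n)).le
  rw [hkFunction_uvAdd]
  refine (Finset.sum_le_card_nsmul _ _ _ fun j _ ↦ add_le_add (h j) (h (j + 1))).trans ?_
  rw [Finset.card_range, smul_eq_mul, pow_succ]
  exact le_of_eq (by ring)

/-- The factor 1 - 2^(r+1) w makes each term of θ_g at w = 2^(-(r+1)) the difference of two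
consecutive ratios. -/
theorem hkRatio_uvAdd {F : Type*} [Field F] {σ : Type*} [Fintype σ] (g : MvPowerSeries σ F)
    (n : ℕ) : hkRatio (uvAdd g) n = ∑ k ∈ Finset.range (n + 1),
      ((PowerSeries.coeff k (theta g) : ℤ) : ℝ) * (1 / (2 : ℝ) ^ (1 + Fintype.card σ)) ^ k := by
  have hcard : Fintype.card (σ ⊕ Fin 2) - 1 = 1 + Fintype.card σ := by
    rw [Fintype.card_sum, Fintype.card_fin]
    omega
  have hr (k : ℕ) : hkRatio (uvAdd g) k =
      (hkFunction (uvAdd g) k : ℝ) * (1 / (2 : ℝ) ^ (1 + Fintype.card σ)) ^ k := by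
    rw [hkRatio, hcard, pow_right_comm, one_div_pow, mul_one_div]
  have hpos : (2 : ℝ) ^ (1 + Fintype.card σ) ≠ 0 := by positivity
  induction n with
  | zero =>
    rw [hr, Finset.sum_range_one, theta]
    simp
  | succ n ih =>
    rw [Finset.sum_range_succ, ← ih, hr, hr, theta, sub_mul, one_mul, map_sub, mul_assoc,
      PowerSeries.coeff_C_mul, PowerSeries.coeff_mk, PowerSeries.coeff_succ_X_mul,
      PowerSeries.coeff_mk, add_comm (Fintype.card σ)]
    push_cast
    rw [pow_succ]
    field_simp
    ring

end MvPowerSeries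

end

theorem corollary1p7 {F : Type*} [Field F] [CharP F 2] {ι : Type*} [Fintype ι] (r : ι → ℕ)
    (g : ∀ i, MvPowerSeries (Fin (r i)) F)
    (hg : ∀ i, MvPowerSeries.constantCoeff (g i) = 0) :
    Tendsto (hkRatio (uvAdd (disjointSum g))) atTop
        (𝓝 (hkMultiplicity (uvAdd (disjointSum g)))) ∧
      HasSum
        (fun n : ℕ ↦ ((PowerSeries.coeff n (hadamardProd fun i ↦ theta (g i)) : ℤ) : ℝ) *
          (1 / (2 : ℝ) ^ (1 + ∑ i, r i)) ^ n)
        (hkMultiplicity (uvAdd (disjointSum g))) := by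
  have hcard : Fintype.card (Σ i, Fin (r i)) = ∑ i, r i := by simp
  have hcoeff (n : ℕ) : PowerSeries.coeff n (hadamardProd fun i ↦ theta (g i)) =
      PowerSeries.coeff n (theta (disjointSum g)) := by
    rw [hadamardProd, PowerSeries.coeff_mk, MvPowerSeries.coeff_theta,
      MvPowerSeries.oddBlocks_disjointSum n g hg]
    exact Finset.prod_congr rfl fun i _ ↦ MvPowerSeries.coeff_theta _ _
  simp only [hcoeff, ← hcard]
  set u : ℕ → ℝ := fun n ↦ ((PowerSeries.coeff n (theta (disjointSum g)) : ℤ) : ℝ) *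
    (1 / (2 : ℝ) ^ (1 + Fintype.card (Σ i, Fin (r i)))) ^ n
  have hratio (n : ℕ) : hkRatio (uvAdd (disjointSum g)) n = ∑ k ∈ Finset.range (n + 1), u k :=
    MvPowerSeries.hkRatio_uvAdd _ n
  have hu (n : ℕ) : 0 ≤ u n := by
    refine mul_nonneg (Int.cast_nonneg ?_) (by positivity)
    rw [MvPowerSeries.coeff_theta]
    exact MvPowerSeries.oddBlocks_truncMul_nonneg n (MvPowerSeries.constantCoeff_disjointSum hg)
  have hle (n : ℕ) : hkRatio (uvAdd (disjointSum g)) n ≤ 2 := by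
    rw [hkRatio, div_le_iff₀ (by positivity), Fintype.card_sum, Fintype.card_fin]
    exact_mod_cast MvPowerSeries.hkFunction_uvAdd_le (disjointSum g) n
  -- The ratio at n sums n + 1 terms, so it dominates the sum of the first n.
  have hsum : Summable u := by
    refine summable_of_sum_range_le (c := 2) hu fun n ↦ ?_
    refine le_trans ?_ (hratio n ▸ hle n)
    exact Finset.sum_le_sum_of_subset_of_nonneg (by simp) fun k _ _ ↦ hu k
  have htend : Tendsto (hkRatio (uvAdd (disjointSum g))) atTop (𝓝 (∑' n, u n)) := by
    rw [funext hratio]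
    exact hsum.hasSum.tendsto_sum_nat.comp (tendsto_add_atTop_nat 1)
  have hlim : hkMultiplicity (uvAdd (disjointSum g)) = ∑' n, u n := htend.limUnder_eq
  rw [hlim]
  exact ⟨htend, hsum.hasSum⟩
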